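/- Let $G$ be a finite simple undirected connected graph with vertex set $V(G)$ and shortest-path metric $d$. Call $G$ *geodetic* if between any two vertices there is only one shortest path, and *ptolemaic* if $$d(x,y)\,d(z,w)+d(y,z)\,d(x,w)\ \ge\ d(x,z)\,d(y,w)\qquad\text{for all } x,y,z,w\in V(G).$$ For integers $k,l\ge 0$ let $MC_{k,l}(G)$ be the free abelian group on the sequences $(x_0,\ldots,x_k)\in V(G)^{k+1}$ with $x_i\ne x_{i+1}$ for all $i$ and $\ell(x_0,\ldots,x_k):=\sum_{i=0}^{k-1} d(x_i,x_{i+1})=l$, with differential $\partial:MC_{k,l}(G)\to MC_{k-1,l}(G)$, $\partial=\sum_{i=1}^{k-1}(-1)^i\partial_i$, where $\partial_i(x_0,\ldots,x_k)=(x_0,\ldots,\widehat{x_i},\ldots,x_k)$ if deleting $x_i$ leaves the length $\ell$ unchanged, and $\partial_i(x_0,\ldots,x_k)=0$ otherwise. Let $MH_{k,l}(G)=H_k(MC_{*,l}(G))$ be the magnitude homology of $G$, and call $G$ *diagonal* if $MH_{k,l}(G)\ne 0$ only if $k=l$. **Theorem.** If $G$ is both geodetic and ptolemaic, then $G$ is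 diagonal. -/

import Mathlib

open CategoryTheory

universe u

namespace MagnitudeHomology

/-- The length `d(x₀,x₁) + ⋯ + d(x_{k-1},x_k)` of a sequence `(x₀,…,x_k)` of vertices of `G`.
It is computed in `ℕ∞`, so a sequence that jumps between two connected components has length `⊤`. -/
noncomputable def seqLength {V : Type u} (G : SimpleGraph V) {k : ℕ} (x : Fin (k + 1) → V) : ℕ∞ :=
  ∑ i : Fin k, G.edist (x i.castSucc) (x i.succ)

/-- Consecutive entries of the sequence are distinct. -/
def NonDegenerate {V : Type u} {k : ℕ} (x : Fin (k + 1) → V) : Prop :=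
  ∀ i : Fin k, x i.castSucc ≠ x i.succ

/-- The basis of `MC_{k,l}(G)`: sequences `(x₀,…,x_k)` of length `l` with `xᵢ ≠ xᵢ₊₁` for all `i`. -/
structure Generator {V : Type u} (G : SimpleGraph V) (k l : ℕ) : Type u where
  /-- The underlying sequence `(x₀,…,x_k)`. -/
  seq : Fin (k + 1) → V
  nonDegenerate : NonDegenerate seq
  length_eq : seqLength G seq = (l : ℕ∞)

/-- The sequence `(x₀,…,x̂ᵢ,…,x_{k+1})` obtained by deleting the entry `xᵢ`. -/
def deleteAt {V : Type u} {k : ℕ} (i : Fin (k + 2)) (x : Fin (k + 2) → V) : Fin (k + 1) → V :=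
  fun j => x (i.succAbove j)

theorem seqLength_succ {V : Type u} (G : SimpleGraph V) {k : ℕ} (x : Fin (k + 2) → V) :
    seqLength G x = G.edist (x 0) (x 1) + seqLength G (fun j => x j.succ) := by
  unfold seqLength
  rw [Fin.sum_univ_succ]
  rfl

theorem nonDegenerate_succ {V : Type u} {k : ℕ} (x : Fin (k + 2) → V) :
    NonDegenerate x ↔ x 0 ≠ x 1 ∧ NonDegenerate (fun j => x j.succ) := by
  unfold NonDegenerate
  rw [Fin.forall_fin_succ]
  rfl

theorem deleteAt_zero {V : Type u} {k : ℕ} (x : Fin (k + 2) → V) :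
    deleteAt 0 x = fun j => x j.succ := by
  funext j
  simp [deleteAt]

theorem deleteAt_succ_tail {V : Type u} {k : ℕ} (i : Fin (k + 2)) (x : Fin (k + 3) → V) :
    (fun j : Fin (k + 1) => deleteAt i.succ x j.succ) = deleteAt i (fun j => x j.succ) := by
  funext j
  simp [deleteAt]

/-- Deleting an entry does not increase the length. -/
theorem seqLength_deleteAt_le {V : Type u} (G : SimpleGraph V) {k : ℕ} (i : Fin (k + 2))
    (x : Fin (k + 2) → V) : seqLength G (deleteAt i x) ≤ seqLength G x := by
  induction k with
  | zero => simp [seqLength]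
  | succ k ih =>
    refine Fin.cases ?_ (fun i => ?_) i
    · rw [deleteAt_zero, seqLength_succ G x]
      exact le_add_self
    · rw [seqLength_succ G (deleteAt i.succ x), deleteAt_succ_tail, seqLength_succ G x]
      refine Fin.cases ?_ (fun i => ?_) i
      · rw [deleteAt_zero, seqLength_succ G (fun j => x j.succ), ← add_assoc]
        gcongr
        exact G.edist_triangle
      · have h1 : deleteAt i.succ.succ x 0 = x 0 := rfl
        have h2 : deleteAt i.succ.succ x 1 = x 1 := rfl
        rw [h1, h2]
        gcongr
        exact ih _ _

/-- Deleting an entry without changing the (finite) length keeps consecutive entries distinct. -/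
theorem nonDegenerate_deleteAt {V : Type u} (G : SimpleGraph V) {k : ℕ} (i : Fin (k + 2))
    (x : Fin (k + 2) → V) (hx : NonDegenerate x) (hfin : seqLength G x ≠ ⊤)
    (h : seqLength G (deleteAt i x) = seqLength G x) : NonDegenerate (deleteAt i x) := by
  induction k with
  | zero => exact fun j => j.elim0
  | succ k ih =>
    revert h
    refine Fin.cases ?_ (fun i => ?_) i
    · intro _
      rw [deleteAt_zero]
      exact ((nonDegenerate_succ x).1 hx).2
    · rw [seqLength_succ G (deleteAt i.succ x), deleteAt_succ_tail,
        nonDegenerate_succ (deleteAt i.succ x), deleteAt_succ_tail]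
      rw [nonDegenerate_succ] at hx
      rw [seqLength_succ] at hfin ⊢
      have hfin' := WithTop.add_ne_top.1 hfin
      refine Fin.cases ?_ (fun i => ?_) i
      · have h1 : deleteAt (Fin.succ 0) x 0 = x 0 := rfl
        have h2 : deleteAt (Fin.succ 0) x 1 = x 2 := rfl
        rw [deleteAt_zero, h1, h2]
        intro h
        have hx2 := (nonDegenerate_succ _).1 hx.2
        refine ⟨fun he => ?_, hx2.2⟩
        rw [seqLength_succ G (fun j => x j.succ)] at h hfin'
        have hL := (WithTop.add_ne_top.1 hfin'.2).2
        rw [← add_assoc, he, SimpleGraph.edist_self] at h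
        have h0 := WithTop.add_right_cancel hL h
        have h3 := (add_eq_zero.1 h0.symm).2
        exact hx2.1 (SimpleGraph.edist_eq_zero_iff.1 h3)
      · have h1 : deleteAt i.succ.succ x 0 = x 0 := rfl
        have h2 : deleteAt i.succ.succ x 1 = x 1 := rfl
        rw [h1, h2]
        intro h
        exact ⟨hx.1, ih _ _ hx.2 hfin'.2 (WithTop.add_left_cancel hfin'.1 h)⟩

/-- If deleting `xᵢ` does not change the length, the resulting sequence is again a generator. -/
def Generator.delete {V : Type u} {G : SimpleGraph V} {k l : ℕ} (i : Fin (k + 2))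
    (x : Generator G (k + 1) l) (h : seqLength G (deleteAt i x.seq) = (l : ℕ∞)) :
    Generator G k l where
  seq := deleteAt i x.seq
  nonDegenerate := nonDegenerate_deleteAt G i x.seq x.nonDegenerate
    (by rw [x.length_eq]; exact ENat.natCast_ne_top l) (h.trans x.length_eq.symm)
  length_eq := h

open Classical in
/-- `∂ᵢ(x₀,…,x_{k+1})`: the sequence with `xᵢ` deleted if it still has length `l`, and `0` if not. -/
noncomputable def face {V : Type u} (G : SimpleGraph V) {k l : ℕ} (i : Fin (k + 2))
    (x : Generator G (k + 1) l) : Generator G k l →₀ ℤ :=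
  if h : seqLength G (deleteAt i x.seq) = (l : ℕ∞) then Finsupp.single (x.delete i h) 1 else 0

/-- `∂(x₀,…,x_{k+1}) = ∑_{1 ≤ i ≤ k} (-1)ⁱ ∂ᵢ(x₀,…,x_{k+1})`, extended linearly to
`MC_{k+1,l}(G) → MC_{k,l}(G)`. -/
noncomputable def boundary {V : Type u} (G : SimpleGraph V) (k l : ℕ) :
    (Generator G (k + 1) l →₀ ℤ) →ₗ[ℤ] (Generator G k l →₀ ℤ) :=
  Finsupp.linearCombination ℤ fun x : Generator G (k + 1) l =>
    ∑ i ∈ Finset.Ioo (0 : Fin (k + 2)) (Fin.last (k + 1)), (-1 : ℤ) ^ (i : ℕ) • face G i x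

theorem boundary_single {V : Type u} (G : SimpleGraph V) (k l : ℕ) (x : Generator G (k + 1) l) :
    boundary G k l (Finsupp.single x 1) =
      ∑ i ∈ Finset.Ioo (0 : Fin (k + 2)) (Fin.last (k + 1)), (-1 : ℤ) ^ (i : ℕ) • face G i x := by
  simp [boundary]

open Classical in
/-- The basis element given by a sequence `y`, and `0` if `y` does not belong to the basis. -/
noncomputable def toChain {V : Type u} (G : SimpleGraph V) (k l : ℕ) (y : Fin (k + 1) → V) :
    Generator G k l →₀ ℤ :=
  if h : NonDegenerate y ∧ seqLength G y = (l : ℕ∞) then Finsupp.single ⟨y, h.1, h.2⟩ 1 else 0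

theorem boundary_face {V : Type u} (G : SimpleGraph V) {k l : ℕ} (i : Fin (k + 3))
    (x : Generator G (k + 2) l) :
    boundary G k l (face G i x) =
      ∑ j ∈ Finset.Ioo (0 : Fin (k + 2)) (Fin.last (k + 1)),
        (-1 : ℤ) ^ (j : ℕ) • toChain G k l (deleteAt j (deleteAt i x.seq)) := by
  by_cases h1 : seqLength G (deleteAt i x.seq) = (l : ℕ∞)
  · rw [face, dif_pos h1, boundary_single]
    refine Finset.sum_congr rfl fun j _ => ?_
    congr 1
    rw [face, toChain]
    by_cases h2 : seqLength G (deleteAt j (deleteAt i x.seq)) = (l : ℕ∞)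
    · have h2' : seqLength G (deleteAt j (x.delete i h1).seq) = (l : ℕ∞) := h2
      have h3 := ((x.delete i h1).delete j h2).nonDegenerate
      rw [dif_pos h2', dif_pos ⟨h3, h2⟩]
      rfl
    · have h2' : ¬ seqLength G (deleteAt j (x.delete i h1).seq) = (l : ℕ∞) := h2
      rw [dif_neg h2', dif_neg (fun h => h2 h.2)]
  · rw [face, dif_neg h1, map_zero]
    refine (Finset.sum_eq_zero fun j _ => ?_).symm
    rw [toChain, dif_neg, smul_zero]
    rintro ⟨-, h2⟩
    apply h1
    apply le_antisymm
    · rw [← x.length_eq]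
      exact seqLength_deleteAt_le G i x.seq
    · rw [← h2]
      exact seqLength_deleteAt_le G j _

/-- Deleting two entries in either order gives the same sequence. -/
theorem deleteAt_deleteAt {V : Type u} {k : ℕ} (i j : Fin (k + 2)) (hij : i ≤ j)
    (x : Fin (k + 3) → V) :
    deleteAt i (deleteAt j.succ x) = deleteAt j (deleteAt i.castSucc x) := by
  funext m
  unfold deleteAt
  congr 1
  have h1 : (i : ℕ) ≤ j := hij
  ext
  simp only [Fin.succAbove, Fin.lt_def, Fin.val_castSucc, Fin.val_succ]
  split_ifs <;> simp only [Fin.val_castSucc, Fin.val_succ] at * <;> omega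

theorem boundary_comp_boundary {V : Type u} (G : SimpleGraph V) (k l : ℕ) :
    boundary G k l ∘ₗ boundary G (k + 1) l = 0 := by
  refine Finsupp.lhom_ext' fun x => LinearMap.ext_ring ?_
  rw [LinearMap.comp_apply, LinearMap.comp_apply, Finsupp.lsingle_apply, boundary_single, map_sum]
  simp_rw [map_smul, boundary_face, Finset.smul_sum, smul_smul, ← pow_add]
  rw [← Finset.sum_product']
  refine Finset.sum_involution
    (fun p _ => if h : p.2.castSucc < p.1 then
        (p.2.castSucc, p.1.pred (Fin.ne_zero_of_lt h))
      else (p.2.succ, p.1.castPred (fun he => h (by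
        rw [he]; exact Fin.castSucc_lt_last _)))) ?_ ?_ ?_ ?_
  · rintro ⟨i, j⟩ hp
    dsimp only
    split_ifs with h
    · obtain ⟨i, rfl⟩ := Fin.exists_succ_eq.2 (Fin.ne_zero_of_lt h)
      have hle : j ≤ i := Fin.castSucc_lt_succ_iff.1 h
      simp only [Fin.pred_succ]
      rw [deleteAt_deleteAt j i hle, ← add_smul]
      rw [Fin.val_succ, Fin.val_castSucc]
      rw [show (-1 : ℤ) ^ ((i : ℕ) + 1 + (j : ℕ)) + (-1) ^ ((j : ℕ) + (i : ℕ)) = 0 by ring]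
      exact zero_smul _ _
    · have hne : i ≠ Fin.last _ := fun he => h (by rw [he]; exact Fin.castSucc_lt_last _)
      obtain ⟨i, rfl⟩ := Fin.exists_castSucc_eq.2 hne
      have hle : i ≤ j := by simpa using h
      simp only [Fin.castPred_castSucc]
      rw [deleteAt_deleteAt i j hle, ← add_smul]
      rw [Fin.val_succ, Fin.val_castSucc]
      rw [show (-1 : ℤ) ^ ((i : ℕ) + (j : ℕ)) + (-1) ^ ((j : ℕ) + 1 + (i : ℕ)) = 0 by ring]
      exact zero_smul _ _
  · rintro ⟨i, j⟩ hp -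
    dsimp only
    split_ifs with h
    · intro he
      have := congrArg Prod.fst he
      exact absurd this h.ne
    · intro he
      have h1 : j.succ = i := congrArg Prod.fst he
      exact h (by rw [← h1]; exact Fin.castSucc_lt_succ)
  · rintro ⟨i, j⟩ hp
    simp only [Finset.mem_product, Finset.mem_Ioo, Fin.lt_def, Fin.val_zero, Fin.val_last] at hp
    dsimp only
    split_ifs with h
    · rw [Fin.lt_def, Fin.val_castSucc] at h
      simp only [Finset.mem_product, Finset.mem_Ioo, Fin.lt_def, Fin.val_zero, Fin.val_last,
        Fin.val_castSucc, Fin.val_pred]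
      omega
    · rw [Fin.lt_def, Fin.val_castSucc] at h
      simp only [Finset.mem_product, Finset.mem_Ioo, Fin.lt_def, Fin.val_zero, Fin.val_last,
        Fin.val_succ, Fin.coe_castPred]
      omega
  · rintro ⟨i, j⟩ hp
    dsimp only
    by_cases h : j.castSucc < i
    · obtain ⟨i, rfl⟩ := Fin.exists_succ_eq.2 (Fin.ne_zero_of_lt h)
      have hle : j ≤ i := Fin.castSucc_lt_succ_iff.1 h
      have h' : ¬ i.castSucc < j.castSucc := by simpa using hle
      simp [h, h']
    · have hne : i ≠ Fin.last _ := fun he => h (by rw [he]; exact Fin.castSucc_lt_last _)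
      obtain ⟨i, rfl⟩ := Fin.exists_castSucc_eq.2 hne
      have hle : i ≤ j := by simpa using h
      have h' : i.castSucc < j.succ := Fin.castSucc_lt_succ_iff.2 hle
      simp [h, h']

/-- The magnitude chain complex `MC_{*,l}(G)` in length grading `l`. -/
noncomputable def magnitudeComplex {V : Type u} (G : SimpleGraph V) (l : ℕ) :
    ChainComplex (ModuleCat.{u} ℤ) ℕ :=
  ChainComplex.of (fun k => ModuleCat.of ℤ (Generator G k l →₀ ℤ))
    (fun k => ModuleCat.ofHom (boundary G k l))
    (fun k => by rw [← ModuleCat.ofHom_comp, boundary_comp_boundary]; rfl)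

/-- Magnitude homology `MH_{k,l}(G) = H_k(MC_{*,l}(G))`. -/
noncomputable def magnitudeHomology {V : Type u} (G : SimpleGraph V) (k l : ℕ) :
    ModuleCat.{u} ℤ :=
  (magnitudeComplex G l).homology k

/-- A graph is diagonal if `MH_{k,l}(G) ≠ 0` only if `k = l`. -/
def IsDiagonal {V : Type u} (G : SimpleGraph V) : Prop :=
  ∀ k l : ℕ, ¬ Limits.IsZero (magnitudeHomology G k l) → k = l

/-- A (connected) graph is ptolemaic if its metric satisfies Ptolemy's inequality. -/
def IsPtolemaic {V : Type u} (G : SimpleGraph V) : Prop :=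
  ∀ x y z w : V,
    G.dist x z * G.dist y w ≤ G.dist x y * G.dist z w + G.dist y z * G.dist x w

/-- A graph is geodetic if there is only one shortest path between any two vertices. -/
def IsGeodetic {V : Type u} (G : SimpleGraph V) : Prop :=
  ∀ (u v : V) (p q : G.Walk u v), p.IsPath → q.IsPath →
    p.length = G.dist u v → q.length = G.dist u v → p = q

end MagnitudeHomology

namespace MagnitudeHomology

variable {V : Type u}

/-! Off the diagonal the complex `MC_{*,l}` is contracted by an explicit homotopy `h`, in the manner
of a discrete Morse matching. Call a triple straight if its middle vertex lies on a geodesic between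
the other two. Scan a sequence from the left for the first event: either a gap of length at least
two, or a unit gap that starts a straight triple. In the first case `h` inserts, up to sign, the
next vertex of a geodesic across the gap; in the second case `h` is zero. Insertion turns the first
kind of sequence into the second, and deleting the middle vertex of the straight triple undoes it. A
sequence with no event has only unit gaps, hence `k = l`; so `∂h + h∂ = 1` whenever `k ≠ l`, and
homology vanishes there.

Both hypotheses serve to cancel the remaining terms. Ptolemy's inequality rules out four-point cuts
(`IsPtolemaic.dist_add_add`), so inserting or deleting a vertex on a geodesic does not change which
neighbouring triples are straight. Geodeticity makes the first step of a geodesic unique, so the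
inserted vertex stays the same when the far end of the gap moves further along a geodesic. The
identity itself is `tailBoundaryMap_tailHomotopy`; the rest transports it from lists to the given
complex. -/

/-! ### Straight triples in ptolemaic and geodetic graphs -/

/-- The vertex `b` lies on a shortest path from `a` to `c`. -/
def Between (G : SimpleGraph V) (a b c : V) : Prop :=
  G.dist a b + G.dist b c = G.dist a c

/-- Ptolemy's inequality excludes four-point cuts. -/
theorem IsPtolemaic.dist_add_add {G : SimpleGraph V} (hconn : G.Connected) (hpto : IsPtolemaic G)
    {x y z w : V} (hyz : y ≠ z) (h₁ : Between G x y z) (h₂ : Between G y z w) :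
    G.dist x y + G.dist y z + G.dist z w = G.dist x w := by
  unfold Between at *
  have hpos : 0 < G.dist y z := hconn.pos_dist_of_ne hyz
  have h := hpto x y z w
  have t₁ : G.dist x w ≤ G.dist x y + G.dist y w := hconn.dist_triangle
  rw [← h₁, ← h₂] at h
  -- With `p, q, r` the three consecutive distances, Ptolemy gives `(p+q)(q+r) ≤ pr + q·d(x,w)`,
  -- that is `q(p+q+r) ≤ q·d(x,w)`; cancel `q > 0`.
  have : G.dist x y + G.dist y z + G.dist z w ≤ G.dist x w := by
    refine Nat.le_of_mul_le_mul_left ?_ hpos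
    nlinarith
  omega

/-- Whether `z` can be deleted before `w` is insensitive to replacing its predecessor by another
vertex on the same geodesic. The forward direction is the triangle inequality; only the converse
needs Ptolemy. -/
theorem IsPtolemaic.between_right_iff {G : SimpleGraph V} (hconn : G.Connected)
    (hpto : IsPtolemaic G) {x y z w : V} (hyz : y ≠ z) (h : Between G x y z) :
    Between G x z w ↔ Between G y z w := by
  refine ⟨fun h' => ?_, fun h' => ?_⟩
  · have t₁ : G.dist x w ≤ G.dist x y + G.dist y w := hconn.dist_triangle
    have t₂ : G.dist y w ≤ G.dist y z + G.dist z w := hconn.dist_triangle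
    unfold Between at *
    omega
  · have := hpto.dist_add_add hconn hyz h h'
    unfold Between at *
    omega

theorem IsPtolemaic.between_left_iff {G : SimpleGraph V} (hconn : G.Connected)
    (hpto : IsPtolemaic G) {x y z w : V} (hyz : y ≠ z) (h : Between G y z w) :
    Between G x y w ↔ Between G x y z := by
  refine ⟨fun h' => ?_, fun h' => ?_⟩
  · have t₁ : G.dist x w ≤ G.dist x z + G.dist z w := hconn.dist_triangle
    have t₂ : G.dist x z ≤ G.dist x y + G.dist y z := hconn.dist_triangle
    unfold Between at *
    omega
  · have := hpto.dist_add_add hconn hyz h' h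
    unfold Between at *
    omega

/-- Each candidate first step, followed by a geodesic to `b`, is a shortest walk from `a` to `b`;
the two walks coincide, and so do their second vertices. -/
theorem IsGeodetic.eq_of_between {G : SimpleGraph V} (hconn : G.Connected) (hgeo : IsGeodetic G)
    {a b y y' : V} (hy : G.dist a y = 1) (hyb : Between G a y b)
    (hy' : G.dist a y' = 1) (hyb' : Between G a y' b) : y = y' := by
  obtain ⟨p, hp⟩ := hconn.exists_walk_length_eq_dist y b
  obtain ⟨q, hq⟩ := hconn.exists_walk_length_eq_dist y' b
  have ha : G.Adj a y := SimpleGraph.dist_eq_one_iff_adj.1 hy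
  have ha' : G.Adj a y' := SimpleGraph.dist_eq_one_iff_adj.1 hy'
  unfold Between at hyb hyb'
  have h₁ : (SimpleGraph.Walk.cons ha p).length = G.dist a b := by
    rw [SimpleGraph.Walk.length_cons]; omega
  have h₂ : (SimpleGraph.Walk.cons ha' q).length = G.dist a b := by
    rw [SimpleGraph.Walk.length_cons]; omega
  have := hgeo a b _ _ (SimpleGraph.Walk.isPath_of_length_eq_dist _ h₁)
    (SimpleGraph.Walk.isPath_of_length_eq_dist _ h₂) h₁ h₂
  injection this

theorem exists_dist_eq_one_between {G : SimpleGraph V} (hconn : G.Connected) {a b : V}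
    (hab : a ≠ b) : ∃ y, G.dist a y = 1 ∧ Between G a y b := by
  obtain ⟨p, hp⟩ := hconn.exists_walk_length_eq_dist a b
  cases p with
  | nil => exact absurd rfl hab
  | @cons _ y _ ha q =>
    have h1 := SimpleGraph.dist_eq_one_iff_adj.2 ha
    refine ⟨y, h1, ?_⟩
    rw [SimpleGraph.Walk.length_cons] at hp
    have t₁ : G.dist a b ≤ G.dist a y + G.dist y b := hconn.dist_triangle
    have t₂ := SimpleGraph.dist_le q
    unfold Between
    omega

open Classical in
/-- The second vertex of a shortest path from `a` to `b`. -/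
noncomputable def nextVertex (G : SimpleGraph V) (a b : V) : V :=
  if h : ∃ y, G.dist a y = 1 ∧ Between G a y b then h.choose else a

theorem nextVertex_spec {G : SimpleGraph V} (hconn : G.Connected) {a b : V} (hab : a ≠ b) :
    G.dist a (nextVertex G a b) = 1 ∧ Between G a (nextVertex G a b) b := by
  have h := exists_dist_eq_one_between hconn hab
  rw [nextVertex, dif_pos h]
  exact h.choose_spec

/-! ### Boundary and homotopy by recursion on lists -/

/-- Prepending a vertex to a sequence, extended linearly. -/
noncomputable def consMap (a : V) : (List V →₀ ℤ) →ₗ[ℤ] (List V →₀ ℤ) :=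
  Finsupp.lmapDomain ℤ ℤ (List.cons a)

@[simp]
theorem consMap_single (a : V) (s : List V) (n : ℤ) :
    consMap a (Finsupp.single s n) = Finsupp.single (a :: s) n := by
  simp [consMap]

open Classical in
/-- The boundary of the sequence `a :: s`, with the initial vertex `a` removed from every term. -/
noncomputable def tailBoundary (G : SimpleGraph V) : V → List V → (List V →₀ ℤ)
  | _, [] => 0
  | _, [_] => 0
  | a, b :: c :: t =>
    -(if Between G a b c then Finsupp.single (c :: t) 1 else 0) -
      consMap b (tailBoundary G b (c :: t))

open Classical in
/-- The contracting homotopy on the sequence `a :: s`, with the initial vertex `a` removed. At the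
first place where the sequence has a gap of at least two or a straight triple, it refines the gap
next to its initial vertex, or vanishes if the gap there is one. -/
noncomputable def tailHomotopy (G : SimpleGraph V) : V → List V → (List V →₀ ℤ)
  | _, [] => 0
  | a, [b] => if 2 ≤ G.dist a b then -Finsupp.single [nextVertex G a b, b] 1 else 0
  | a, b :: c :: t =>
    if 2 ≤ G.dist a b then -Finsupp.single (nextVertex G a b :: b :: c :: t) 1
    else if Between G a b c then 0 else -consMap b (tailHomotopy G b (c :: t))

/-- The linear extension of `tailBoundary`. -/
noncomputable def tailBoundaryMap (G : SimpleGraph V) (a : V) :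
    (List V →₀ ℤ) →ₗ[ℤ] (List V →₀ ℤ) :=
  Finsupp.linearCombination ℤ (tailBoundary G a)

/-- The linear extension of `tailHomotopy`. -/
noncomputable def tailHomotopyMap (G : SimpleGraph V) (a : V) :
    (List V →₀ ℤ) →ₗ[ℤ] (List V →₀ ℤ) :=
  Finsupp.linearCombination ℤ (tailHomotopy G a)

@[simp]
theorem tailBoundaryMap_single (G : SimpleGraph V) (a : V) (s : List V) :
    tailBoundaryMap G a (Finsupp.single s 1) = tailBoundary G a s := by
  simp [tailBoundaryMap]

@[simp]
theorem tailHomotopyMap_single (G : SimpleGraph V) (a : V) (s : List V) :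
    tailHomotopyMap G a (Finsupp.single s 1) = tailHomotopy G a s := by
  simp [tailHomotopyMap]

/-- The length of a finite sequence of vertices. -/
noncomputable def listLength (G : SimpleGraph V) : List V → ℕ
  | [] => 0
  | [_] => 0
  | a :: b :: t => G.dist a b + listLength G (b :: t)

theorem tailHomotopy_of_two_le {G : SimpleGraph V} {a b : V} (h : 2 ≤ G.dist a b) (t : List V) :
    tailHomotopy G a (b :: t) = -Finsupp.single (nextVertex G a b :: b :: t) 1 := by
  cases t <;> simp [tailHomotopy, h]

/-- The branch taken by the homotopy depends on at most the first three vertices. On chains whose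
terms share that prefix it is therefore given by one formula; this lemma and the next two treat the
three branches. -/
theorem tailHomotopyMap_comp_consMap_of_two_le {G : SimpleGraph V} {a b : V}
    (h : 2 ≤ G.dist a b) (z : List V →₀ ℤ) :
    tailHomotopyMap G a (consMap b z) = -consMap (nextVertex G a b) (consMap b z) := by
  induction z using Finsupp.induction_linear with
  | zero => simp
  | add x y hx hy => simp only [map_add, hx, hy, neg_add]
  | single s n =>
    simp [tailHomotopyMap, tailHomotopy_of_two_le h]

theorem tailHomotopyMap_comp_consMap_of_between {G : SimpleGraph V} {a b c : V}
    (h : ¬ 2 ≤ G.dist a b) (h' : Between G a b c) (z : List V →₀ ℤ) :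
    tailHomotopyMap G a (consMap b (consMap c z)) = 0 := by
  induction z using Finsupp.induction_linear with
  | zero => simp
  | add x y hx hy => simp only [map_add, hx, hy, add_zero]
  | single s n =>
    simp [tailHomotopyMap, tailHomotopy, h, h']

theorem tailHomotopyMap_comp_consMap_of_not_between {G : SimpleGraph V} {a b c : V}
    (h : ¬ 2 ≤ G.dist a b) (h' : ¬ Between G a b c) (z : List V →₀ ℤ) :
    tailHomotopyMap G a (consMap b (consMap c z)) =
      -consMap b (tailHomotopyMap G b (consMap c z)) := by
  induction z using Finsupp.induction_linear with
  | zero => simp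
  | add x y hx hy => simp only [map_add, hx, hy, neg_add]
  | single s n =>
    simp [tailHomotopyMap, tailHomotopy, h, h']

theorem tailBoundaryMap_comp_consMap_of_not_between {G : SimpleGraph V} {a b c : V}
    (h' : ¬ Between G a b c) (z : List V →₀ ℤ) :
    tailBoundaryMap G a (consMap b (consMap c z)) =
      -consMap b (tailBoundaryMap G b (consMap c z)) := by
  induction z using Finsupp.induction_linear with
  | zero => simp
  | add x y hx hy => simp only [map_add, hx, hy, neg_add]
  | single s n =>
    simp [tailBoundaryMap, tailBoundary, h']

/-! ### The homotopy identity -/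

/-- Deleting the inserted vertex `y` returns the sequence. All other terms cancel: `b` is deletable
after `y` exactly when it is after `a`, the vertex inserted once `b` is gone is again `y`, and later
deletions keep the initial gap. -/
theorem tailBoundaryMap_tailHomotopy_of_two_le {G : SimpleGraph V} (hconn : G.Connected)
    (hgeo : IsGeodetic G) (hpto : IsPtolemaic G) {a b : V} (h : 2 ≤ G.dist a b) (t : List V)
    (ht : List.IsChain (· ≠ ·) (a :: b :: t)) :
    tailBoundaryMap G a (tailHomotopy G a (b :: t)) +
      tailHomotopyMap G a (tailBoundary G a (b :: t)) = Finsupp.single (b :: t) 1 := by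
  have hab : a ≠ b := by rintro rfl; simp at h
  obtain ⟨h₁, h₂⟩ := nextVertex_spec hconn hab
  have hyb : nextVertex G a b ≠ b := by
    intro he; rw [he] at h₁; omega
  cases t with
  | nil => simp [tailHomotopy, h, tailBoundary, h₂]
  | cons c t =>
    have hbc : b ≠ c := by
      rw [List.isChain_cons_cons, List.isChain_cons_cons] at ht
      exact ht.2.1
    rw [tailHomotopy_of_two_le h]
    by_cases hbet : Between G a b c
    · have hac : 2 ≤ G.dist a c := by unfold Between at hbet; omega
      have hac' : a ≠ c := by rintro rfl; simp at hac
      have hy : Between G (nextVertex G a b) b c :=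
        (hpto.between_right_iff hconn hyb h₂).1 hbet
      have hayc : Between G a (nextVertex G a b) c := by
        have := hpto.dist_add_add hconn hyb h₂ hy
        unfold Between at *
        omega
      have hn : nextVertex G a c = nextVertex G a b := by
        obtain ⟨h₃, h₄⟩ := nextVertex_spec hconn hac'
        exact hgeo.eq_of_between hconn h₃ h₄ h₁ hayc
      simp only [map_neg, tailBoundaryMap_single, tailBoundary, if_pos h₂, if_pos hbet, if_pos hy,
        map_sub, consMap_single, tailHomotopyMap_single, tailHomotopy_of_two_le hac, hn,
        tailHomotopyMap_comp_consMap_of_two_le h]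
      abel
    · have hy : ¬ Between G (nextVertex G a b) b c := fun hy =>
        hbet ((hpto.between_right_iff hconn hyb h₂).2 hy)
      simp only [map_neg, tailBoundaryMap_single, tailBoundary, if_pos h₂, if_neg hbet, if_neg hy,
        map_sub, map_zero,
        tailHomotopyMap_comp_consMap_of_two_le h]
      abel

/-- Here the homotopy vanishes on the sequence, which is recovered from the face deleting `b`: by
uniqueness the homotopy reinserts `b` there. -/
theorem tailBoundaryMap_tailHomotopy_of_between {G : SimpleGraph V} (hconn : G.Connected)
    (hgeo : IsGeodetic G) (hpto : IsPtolemaic G) {a b c : V} (h : G.dist a b = 1)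
    (hbet : Between G a b c) (t : List V) (ht : List.IsChain (· ≠ ·) (b :: c :: t)) :
    tailBoundaryMap G a (tailHomotopy G a (b :: c :: t)) +
      tailHomotopyMap G a (tailBoundary G a (b :: c :: t)) = Finsupp.single (b :: c :: t) 1 := by
  have h2 : ¬ 2 ≤ G.dist a b := by omega
  rw [List.isChain_cons_cons] at ht
  have hbc : 0 < G.dist b c := hconn.pos_dist_of_ne ht.1
  have hac : 2 ≤ G.dist a c := by unfold Between at hbet; omega
  have hac' : a ≠ c := by rintro rfl; simp at hac
  have hn : nextVertex G a c = b := by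
    obtain ⟨h₃, h₄⟩ := nextVertex_spec hconn hac'
    exact hgeo.eq_of_between hconn h₃ h₄ h hbet
  -- Every other face still begins with a unit gap and a straight triple, even after `c` is deleted,
  -- so the homotopy kills it.
  have hrest : tailHomotopyMap G a (consMap b (tailBoundary G b (c :: t))) = 0 := by
    cases t with
    | nil => simp [tailBoundary]
    | cons d t =>
      rw [tailBoundary, map_sub, map_sub, tailHomotopyMap_comp_consMap_of_between h2 hbet, sub_zero]
      by_cases hd : Between G b c d
      · have := (hpto.between_left_iff hconn ht.1 hd).2 hbet
        rw [if_pos hd, map_neg, consMap_single, map_neg, tailHomotopyMap_single, tailHomotopy,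
          if_neg h2, if_pos this, neg_zero]
      · simp [hd]
  rw [tailHomotopy, if_neg h2, if_pos hbet, tailBoundary, if_pos hbet, map_sub, hrest]
  simp [tailHomotopy_of_two_le hac, hn]

/-- If there is no event at `a`, both operators pass over `b` with a minus sign, and the signs
cancel in each composite. A unit gap contributes one to both the number of steps and the length, so
their inequality descends to the tail and excludes the base cases. -/
theorem tailBoundaryMap_tailHomotopy {G : SimpleGraph V} (hconn : G.Connected)
    (hgeo : IsGeodetic G) (hpto : IsPtolemaic G) (s : List V) : ∀ a : V,
    List.IsChain (· ≠ ·) (a :: s) → s.length ≠ listLength G (a :: s) →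
    tailBoundaryMap G a (tailHomotopy G a s) + tailHomotopyMap G a (tailBoundary G a s) =
      Finsupp.single s 1 := by
  induction s with
  | nil => intro a _ h; simp [listLength] at h
  | cons b t ih =>
    intro a hch hlen
    by_cases h2 : 2 ≤ G.dist a b
    · exact tailBoundaryMap_tailHomotopy_of_two_le hconn hgeo hpto h2 t hch
    have hch' := List.isChain_cons_cons.1 hch
    have h1 : G.dist a b = 1 := by
      have : 0 < G.dist a b := hconn.pos_dist_of_ne hch'.1
      omega
    cases t with
    | nil => simp [listLength, h1] at hlen
    | cons c t =>
      by_cases hbet : Between G a b c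
      · exact tailBoundaryMap_tailHomotopy_of_between hconn hgeo hpto h1 hbet t hch'.2
      have hbc : b ≠ c := (List.isChain_cons_cons.1 hch'.2).1
      have hih := ih b hch'.2 (by
        intro he
        apply hlen
        rw [listLength, ← he, h1, List.length_cons, add_comm])
      have hD : tailBoundaryMap G a (consMap b (tailHomotopy G b (c :: t))) =
          -consMap b (tailBoundaryMap G b (tailHomotopy G b (c :: t))) := by
        by_cases h : 2 ≤ G.dist b c
        · obtain ⟨h₁, h₂⟩ := nextVertex_spec hconn hbc
          have hyc : nextVertex G b c ≠ b := by intro he; rw [he] at h₁; simp at h₁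
          -- The inserted vertex must not make `b` deletable: a straight triple with `nextVertex G b
          -- c` would extend to one with `c`.
          have hy : ¬ Between G a b (nextVertex G b c) := fun hy =>
            hbet ((hpto.between_left_iff hconn hyc.symm h₂).2 hy)
          rw [tailHomotopy_of_two_le h, ← consMap_single, map_neg, map_neg, map_neg, map_neg,
            tailBoundaryMap_comp_consMap_of_not_between hy]
        · cases t with
          | nil => simp [tailHomotopy, h]
          | cons d t =>
            rw [tailHomotopy, if_neg h]
            split_ifs
            · simp
            · rw [map_neg, map_neg, map_neg, map_neg,
                tailBoundaryMap_comp_consMap_of_not_between hbet]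
      have hH : tailHomotopyMap G a (consMap b (tailBoundary G b (c :: t))) =
          -consMap b (tailHomotopyMap G b (tailBoundary G b (c :: t))) := by
        cases t with
        | nil => simp [tailBoundary]
        | cons d t =>
          rw [tailBoundary]
          simp only [map_sub, map_neg, tailHomotopyMap_comp_consMap_of_not_between h2 hbet]
          -- Deleting `c` makes `a, b, d` the leading triple, which is not straight because `a, b,
          -- c` is not.
          by_cases hd : Between G b c d
          · have := mt (hpto.between_left_iff hconn hbc hd).1 hbet
            rw [if_pos hd, ← consMap_single,
              tailHomotopyMap_comp_consMap_of_not_between h2 this]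
            abel
          · simp [hd]
      rw [tailHomotopy, if_neg h2, if_neg hbet, tailBoundary, if_neg hbet, neg_zero, zero_sub,
        map_neg, map_neg, hD, hH, neg_neg, neg_neg, ← map_add, hih, consMap_single]

/-- The boundary of a sequence given as a list, extended linearly. -/
noncomputable def listBoundary (G : SimpleGraph V) : (List V →₀ ℤ) →ₗ[ℤ] (List V →₀ ℤ) :=
  Finsupp.linearCombination ℤ fun L => match L with
    | [] => 0
    | a :: s => consMap a (tailBoundary G a s)

/-- The contracting homotopy on sequences given as lists, extended linearly. -/
noncomputable def listHomotopy (G : SimpleGraph V) : (List V →₀ ℤ) →ₗ[ℤ] (List V →₀ ℤ) :=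
  Finsupp.linearCombination ℤ fun L => match L with
    | [] => 0
    | a :: s => consMap a (tailHomotopy G a s)

theorem listBoundary_comp_consMap (G : SimpleGraph V) (a : V) (z : List V →₀ ℤ) :
    listBoundary G (consMap a z) = consMap a (tailBoundaryMap G a z) := by
  induction z using Finsupp.induction_linear with
  | zero => simp
  | add x y hx hy => simp only [map_add, hx, hy]
  | single s n => simp [listBoundary, tailBoundaryMap]

theorem listHomotopy_comp_consMap (G : SimpleGraph V) (a : V) (z : List V →₀ ℤ) :
    listHomotopy G (consMap a z) = consMap a (tailHomotopyMap G a z) := by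
  induction z using Finsupp.induction_linear with
  | zero => simp
  | add x y hx hy => simp only [map_add, hx, hy]
  | single s n => simp [listHomotopy, tailHomotopyMap]

/-! ### Degree and length of the homotopy -/

/-- The lists of `k + 1` vertices that generate the magnitude chains of length `l`. -/
def IsListGenerator (G : SimpleGraph V) (k l : ℕ) (L : List V) : Prop :=
  L.IsChain (· ≠ ·) ∧ L.length = k + 1 ∧ listLength G L = l

theorem listBoundary_listHomotopy {G : SimpleGraph V} (hconn : G.Connected)
    (hgeo : IsGeodetic G) (hpto : IsPtolemaic G) {k l : ℕ} (hkl : k ≠ l) {L : List V}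
    (hL : IsListGenerator G k l L) :
    listBoundary G (listHomotopy G (Finsupp.single L 1)) +
      listHomotopy G (listBoundary G (Finsupp.single L 1)) = Finsupp.single L 1 := by
  obtain ⟨h₁, h₂, h₃⟩ := hL
  cases L with
  | nil => simp at h₂
  | cons a s =>
    have hs : s.length = k := by simpa using h₂
    rw [← consMap_single, listHomotopy_comp_consMap, listBoundary_comp_consMap,
      listBoundary_comp_consMap, listHomotopy_comp_consMap, ← map_add, tailHomotopyMap_single,
      tailBoundaryMap_single, tailBoundaryMap_tailHomotopy hconn hgeo hpto s a h₁ (by omega)]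

theorem consMap_mem_supported {P : List V → Prop} {a : V} {z : List V →₀ ℤ}
    (h : z ∈ Finsupp.supported ℤ ℤ {s | P (a :: s)}) :
    consMap a z ∈ Finsupp.supported ℤ ℤ {s | P s} := by
  classical
  rw [Finsupp.mem_supported] at h ⊢
  intro t ht
  obtain ⟨s, hs, rfl⟩ := Finset.mem_image.1 (Finsupp.mapDomain_support ht)
  exact h hs

theorem tailHomotopy_mem_supported {G : SimpleGraph V} (hconn : G.Connected)
    (s : List V) : ∀ (a : V) (k l : ℕ), IsListGenerator G k l (a :: s) →
    tailHomotopy G a s ∈ Finsupp.supported ℤ ℤ {t | IsListGenerator G (k + 1) l (a :: t)} := by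
  induction s with
  | nil => intro a k l _; rw [tailHomotopy]; exact Submodule.zero_mem _
  | cons b t ih =>
    intro a k l hs
    obtain ⟨h₁, h₂, h₃⟩ := hs
    have h₁' := List.isChain_cons_cons.1 h₁
    by_cases h2 : 2 ≤ G.dist a b
    · rw [tailHomotopy_of_two_le h2]
      obtain ⟨hy, hyb⟩ := nextVertex_spec hconn h₁'.1
      refine Submodule.neg_mem _ (Finsupp.single_mem_supported ℤ _ ⟨?_, ?_, ?_⟩)
      · rw [List.isChain_cons_cons, List.isChain_cons_cons]
        refine ⟨fun he => ?_, fun he => ?_, h₁'.2⟩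
        · rw [← he] at hy; simp at hy
        · rw [he] at hy; omega
      · simpa using h₂
      · rw [listLength] at h₃
        rw [listLength, listLength, ← add_assoc, hyb, h₃]
    · cases t with
      | nil => rw [tailHomotopy, if_neg h2]; exact Submodule.zero_mem _
      | cons c t =>
        rw [tailHomotopy, if_neg h2]
        split_ifs
        · exact Submodule.zero_mem _
        · refine Submodule.neg_mem _ (consMap_mem_supported
            (P := fun s => IsListGenerator G (k + 1) l (a :: s)) ?_)
          -- The subtraction is harmless: the list has at least three vertices, so `k ≥ 2`.
          have := ih b (k - 1) (listLength G (b :: c :: t))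
            ⟨h₁'.2, by simp only [List.length_cons] at h₂ ⊢; omega, rfl⟩
          refine Finsupp.supported_mono ?_ this
          rintro s ⟨g₁, g₂, g₃⟩
          refine ⟨List.isChain_cons_cons.2 ⟨h₁'.1, g₁⟩, ?_, ?_⟩
          · simp only [List.length_cons] at g₂ h₂ ⊢; omega
          · rw [listLength, g₃]; exact h₃

theorem listHomotopy_mem_supported {G : SimpleGraph V} (hconn : G.Connected) {k l : ℕ}
    {L : List V} (hL : IsListGenerator G k l L) :
    listHomotopy G (Finsupp.single L 1) ∈
      Finsupp.supported ℤ ℤ {M | IsListGenerator G (k + 1) l M} := by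
  cases L with
  | nil => simp [IsListGenerator] at hL
  | cons a s =>
    rw [← consMap_single, listHomotopy_comp_consMap, tailHomotopyMap_single]
    exact consMap_mem_supported (P := fun s => IsListGenerator G (k + 1) l s)
      (tailHomotopy_mem_supported hconn s a k l hL)

/-! ### Comparison with the magnitude complex -/

theorem coe_listLength_ofFn {G : SimpleGraph V} (hconn : G.Connected) {k : ℕ}
    (x : Fin (k + 1) → V) : (listLength G (List.ofFn x) : ℕ∞) = seqLength G x := by
  induction k with
  | zero => simp [listLength, seqLength]
  | succ k ih =>
    rw [seqLength_succ, ← ih, List.ofFn_succ, List.ofFn_succ, listLength, Nat.cast_add,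
      (hconn _ _).coe_dist_eq_edist]
    rfl

theorem isListGenerator_ofFn_iff {G : SimpleGraph V} (hconn : G.Connected) {k l : ℕ}
    (x : Fin (k + 1) → V) :
    IsListGenerator G k l (List.ofFn x) ↔ NonDegenerate x ∧ seqLength G x = (l : ℕ∞) := by
  rw [IsListGenerator, List.isChain_ofFn, ← coe_listLength_ofFn hconn]
  simp only [List.length_ofFn, true_and, Nat.cast_inj]
  refine and_congr_left fun _ => ⟨fun h i => h i (by omega), fun h i hi => h ⟨i, by omega⟩⟩

theorem Generator.ofFn_injective (G : SimpleGraph V) (k l : ℕ) :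
    Function.Injective fun g : Generator G k l => List.ofFn g.seq := by
  rintro ⟨x, _, _⟩ ⟨y, _, _⟩ h
  have : x = y := List.ofFn_injective h
  subst this
  rfl

/-- The inclusion of the magnitude chains into the chains on lists. -/
noncomputable def toListChain (G : SimpleGraph V) (k l : ℕ) :
    (Generator G k l →₀ ℤ) →ₗ[ℤ] (List V →₀ ℤ) :=
  Finsupp.lmapDomain ℤ ℤ fun g : Generator G k l => List.ofFn g.seq

theorem toListChain_injective (G : SimpleGraph V) (k l : ℕ) :
    Function.Injective (toListChain G k l) :=
  Finsupp.mapDomain_injective (Generator.ofFn_injective G k l)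

@[simp]
theorem toListChain_single (G : SimpleGraph V) {k l : ℕ} (g : Generator G k l) (n : ℤ) :
    toListChain G k l (Finsupp.single g n) = Finsupp.single (List.ofFn g.seq) n := by
  simp [toListChain]

/-- This allows a homotopy built on arbitrary lists to be pulled back to magnitude chains: a support
condition suffices. -/
theorem range_toListChain {G : SimpleGraph V} (hconn : G.Connected) (k l : ℕ) :
    LinearMap.range (toListChain G k l) =
      Finsupp.supported ℤ ℤ {L | IsListGenerator G k l L} := by
  rw [toListChain, Finsupp.range_lmapDomain, Finsupp.supported_eq_span_single]
  congr 1
  ext z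
  constructor
  · rintro ⟨g, rfl⟩
    exact ⟨_, (isListGenerator_ofFn_iff hconn g.seq).2 ⟨g.nonDegenerate, g.length_eq⟩, rfl⟩
  · rintro ⟨L, hL, rfl⟩
    obtain ⟨x, rfl⟩ : ∃ x : Fin (k + 1) → V, List.ofFn x = L := by
      have h := hL.2.1
      rw [← h]
      exact ⟨L.get, List.ofFn_get L⟩
    have hx := (isListGenerator_ofFn_iff hconn x).1 hL
    exact ⟨⟨x, hx.1, hx.2⟩, rfl⟩

open Classical in
/-- The `i`-th face of a sequence, as a chain on lists. -/
noncomputable def listFace (G : SimpleGraph V) {k : ℕ} (i : Fin (k + 2)) (x : Fin (k + 2) → V) :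
    List V →₀ ℤ :=
  if seqLength G (deleteAt i x) = seqLength G x then Finsupp.single (List.ofFn (deleteAt i x)) 1
  else 0

theorem toListChain_face (G : SimpleGraph V) {k l : ℕ} (i : Fin (k + 2))
    (x : Generator G (k + 1) l) : toListChain G k l (face G i x) = listFace G i x.seq := by
  rw [face, listFace, x.length_eq]
  split_ifs
  · rw [toListChain_single]; rfl
  · exact map_zero _

theorem ofFn_eq_cons {k : ℕ} (x : Fin (k + 1) → V) :
    List.ofFn x = x 0 :: List.ofFn (fun j => x j.succ) := List.ofFn_succ

theorem listFace_succ_succ {G : SimpleGraph V} (hconn : G.Connected) {k : ℕ} (i : Fin (k + 1))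
    (x : Fin (k + 3) → V) :
    listFace G i.succ.succ x = consMap (x 0) (listFace G i.succ fun j => x j.succ) := by
  have h0 : deleteAt i.succ.succ x 0 = x 0 := rfl
  have h1 : deleteAt i.succ.succ x 1 = x 1 := rfl
  have hfin : G.edist (x 0) (x 1) ≠ ⊤ := by
    rw [← (hconn _ _).coe_dist_eq_edist]; exact ENat.natCast_ne_top _
  have hiff : seqLength G (deleteAt i.succ.succ x) = seqLength G x ↔
      seqLength G (deleteAt i.succ fun j => x j.succ) = seqLength G fun j => x j.succ := by
    rw [seqLength_succ, seqLength_succ G x, h0, h1, deleteAt_succ_tail]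
    exact WithTop.add_left_inj hfin
  rw [listFace, listFace]
  by_cases h : seqLength G (deleteAt i.succ fun j => x j.succ) = seqLength G fun j => x j.succ
  · rw [if_pos h, if_pos (hiff.2 h), consMap_single, ofFn_eq_cons (deleteAt i.succ.succ x), h0,
      deleteAt_succ_tail]
  · rw [if_neg h, if_neg (mt hiff.1 h), map_zero]

open Classical in
theorem listFace_one {G : SimpleGraph V} (hconn : G.Connected) {k : ℕ} (x : Fin (k + 3) → V) :
    listFace G 1 x = if Between G (x 0) (x 1) (x 2) then
      Finsupp.single (x 0 :: List.ofFn fun j : Fin (k + 1) => x j.succ.succ) 1 else 0 := by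
  have h0 : deleteAt (Fin.succ 0) x 0 = x 0 := rfl
  have h1 : deleteAt (Fin.succ 0) x 1 = x 2 := rfl
  have hiff : seqLength G (deleteAt 1 x) = seqLength G x ↔ Between G (x 0) (x 1) (x 2) := by
    rw [← Fin.succ_zero_eq_one, seqLength_succ, h0, h1, deleteAt_succ_tail, deleteAt_zero,
      seqLength_succ G x, seqLength_succ G fun j => x j.succ, ← coe_listLength_ofFn hconn,
      ← (hconn _ _).coe_dist_eq_edist, ← (hconn _ _).coe_dist_eq_edist,
      ← (hconn _ _).coe_dist_eq_edist, Between]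
    norm_cast
    rw [Fin.succ_zero_eq_one]
    change G.dist (x 0) (x 2) + _ = G.dist (x 0) (x 1) + (G.dist (x 1) (x 2) + _) ↔ _
    omega
  have hd : List.ofFn (deleteAt 1 x) =
      x 0 :: List.ofFn fun j : Fin (k + 1) => x j.succ.succ := by
    rw [← Fin.succ_zero_eq_one, ofFn_eq_cons, h0, deleteAt_succ_tail, deleteAt_zero]
  rw [listFace, hd]
  simp only [hiff]

theorem sum_Ioo_zero_last {M : Type*} [AddCommMonoid M] {k : ℕ} (f : Fin (k + 2) → M) :
    ∑ i ∈ Finset.Ioo (0 : Fin (k + 2)) (Fin.last (k + 1)), f i =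
      ∑ i : Fin k, f i.castSucc.succ := by
  symm
  refine Finset.sum_bij (fun i _ => i.castSucc.succ) ?_ ?_ ?_ ?_
  · intro i _
    simp [Fin.lt_def]
  · intro i _ j _ h
    simpa using h
  · intro i hi
    rw [Finset.mem_Ioo, Fin.lt_def, Fin.lt_def] at hi
    simp only [Fin.val_zero, Fin.val_last] at hi
    refine ⟨⟨i - 1, by omega⟩, Finset.mem_univ _, ?_⟩
    ext
    simp
    omega
  · intro i _
    rfl

/-- The minus sign in the recursion of `tailBoundary` is the index shift caused by dropping the
first vertex, so unfolding it yields the alternating signs. -/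
theorem listBoundary_ofFn {G : SimpleGraph V} (hconn : G.Connected) {k : ℕ}
    (x : Fin (k + 2) → V) :
    listBoundary G (Finsupp.single (List.ofFn x) 1) =
      ∑ i : Fin k, (-1 : ℤ) ^ ((i : ℕ) + 1) • listFace G i.castSucc.succ x := by
  classical
  induction k with
  | zero => simp [listBoundary, tailBoundary]
  | succ k ih =>
    have h := ih fun j => x j.succ
    rw [ofFn_eq_cons x, ← consMap_single, listBoundary_comp_consMap, tailBoundaryMap_single,
      ofFn_eq_cons fun j => x j.succ, ofFn_eq_cons fun j : Fin (k + 1) => x j.succ.succ,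
      tailBoundary, map_sub]
    rw [ofFn_eq_cons fun j => x j.succ, ← consMap_single, listBoundary_comp_consMap,
      tailBoundaryMap_single, ofFn_eq_cons fun j : Fin (k + 1) => x j.succ.succ] at h
    rw [h, Fin.sum_univ_succ, map_sum]
    have h1 : listFace G (Fin.castSucc 0).succ x = _ := listFace_one hconn x
    rw [h1, sub_eq_add_neg, ← Finset.sum_neg_distrib]
    congr 1
    · rw [Fin.val_zero, zero_add, pow_one, neg_one_smul, map_neg,
        ofFn_eq_cons fun j : Fin (k + 1) => x j.succ.succ]
      change -(consMap (x 0) (if Between G (x 0) (x 1) (x 2) then _ else _)) = _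
      split_ifs
      · rw [consMap_single]
      · rw [map_zero]
    · refine Finset.sum_congr rfl fun i _ => ?_
      have h2 : listFace G i.succ.castSucc.succ x = _ := listFace_succ_succ hconn i.castSucc x
      rw [h2, map_smul, Fin.val_succ, pow_succ _ ((i : ℕ) + 1), mul_neg_one, neg_smul]

theorem toListChain_boundary {G : SimpleGraph V} (hconn : G.Connected) (k l : ℕ)
    (z : Generator G (k + 1) l →₀ ℤ) :
    toListChain G k l (boundary G k l z) = listBoundary G (toListChain G (k + 1) l z) := by
  suffices h : toListChain G k l ∘ₗ boundary G k l = listBoundary G ∘ₗ toListChain G (k + 1) l from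
    LinearMap.congr_fun h z
  refine Finsupp.lhom_ext' fun x => LinearMap.ext_ring ?_
  simp only [LinearMap.comp_apply, Finsupp.lsingle_apply]
  rw [toListChain_single, boundary_single, map_sum, listBoundary_ofFn hconn, sum_Ioo_zero_last]
  refine Finset.sum_congr rfl fun i _ => ?_
  rw [map_smul, toListChain_face, Fin.val_succ, Fin.val_castSucc]

theorem listBoundary_toListChain_zero (G : SimpleGraph V) (l : ℕ) (z : Generator G 0 l →₀ ℤ) :
    listBoundary G (toListChain G 0 l z) = 0 := by
  induction z using Finsupp.induction_linear with
  | zero => simp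
  | add x y hx hy => rw [map_add, map_add, hx, hy, add_zero]
  | single s n => simp [listBoundary, tailBoundary]

/-! ### Exactness off the diagonal -/

/-- On a cycle the homotopy identity reads `z = ∂(hz)`, and `hz` comes from a magnitude chain.
Stating the cycle condition on lists covers degree zero and positive degrees at once. -/
theorem exists_boundary_eq {G : SimpleGraph V} (hconn : G.Connected) (hgeo : IsGeodetic G)
    (hpto : IsPtolemaic G) {k l : ℕ} (hkl : k ≠ l) (z : Generator G k l →₀ ℤ)
    (hz : listBoundary G (toListChain G k l z) = 0) :
    ∃ w, boundary G k l w = z := by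
  have hid : ∀ u ∈ Finsupp.supported ℤ ℤ {L | IsListGenerator G k l L},
      listBoundary G (listHomotopy G u) + listHomotopy G (listBoundary G u) = u ∧
        listHomotopy G u ∈ Finsupp.supported ℤ ℤ {L | IsListGenerator G (k + 1) l L} := by
    intro u hu
    rw [Finsupp.supported_eq_span_single] at hu
    induction hu using Submodule.span_induction with
    | mem u hu =>
      obtain ⟨L, hL, rfl⟩ := hu
      exact ⟨listBoundary_listHomotopy hconn hgeo hpto hkl hL,
        listHomotopy_mem_supported hconn hL⟩
    | zero => simp
    | add u v _ _ hu hv =>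
      refine ⟨?_, by rw [map_add]; exact Submodule.add_mem _ hu.2 hv.2⟩
      conv_rhs => rw [← hu.1, ← hv.1]
      simp only [map_add]
      abel
    | smul n u _ hu =>
      refine ⟨?_, by rw [map_smul]; exact Submodule.smul_mem _ _ hu.2⟩
      conv_rhs => rw [← hu.1]
      simp only [map_smul, smul_add]
  obtain ⟨h₁, h₂⟩ := hid (toListChain G k l z)
    (range_toListChain hconn k l ▸ LinearMap.mem_range_self _ z)
  rw [← range_toListChain hconn] at h₂
  obtain ⟨w, hw⟩ := h₂
  refine ⟨w, toListChain_injective G k l ?_⟩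
  rwa [toListChain_boundary hconn, hw, ← add_zero (listBoundary G _), ← map_zero (listHomotopy G),
    ← hz]

theorem magnitudeComplex_exactAt {G : SimpleGraph V} (hconn : G.Connected) (hgeo : IsGeodetic G)
    (hpto : IsPtolemaic G) {k l : ℕ} (hkl : k ≠ l) : (magnitudeComplex G l).ExactAt k := by
  have hd : ∀ j, (magnitudeComplex G l).d (j + 1) j = ModuleCat.ofHom (boundary G j l) :=
    fun j => ChainComplex.of_d (fun k => ModuleCat.of ℤ (Generator G k l →₀ ℤ))
      (fun k => ModuleCat.ofHom (boundary G k l)) j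
  cases k with
  | zero =>
    -- The successor of degree `0` is `0` by convention, with zero differential, so every chain is a
    -- cycle.
    rw [HomologicalComplex.exactAt_iff' _ 1 0 0 (by simp) (by simp),
      ShortComplex.moduleCat_exact_iff]
    intro z _
    obtain ⟨w, hw⟩ := exists_boundary_eq hconn hgeo hpto hkl z
      (listBoundary_toListChain_zero G l z)
    refine ⟨w, ?_⟩
    change (magnitudeComplex G l).d 1 0 w = z
    rw [hd 0]
    exact hw
  | succ k =>
    rw [HomologicalComplex.exactAt_iff' _ (k + 2) (k + 1) k (by simp) (by simp),
      ShortComplex.moduleCat_exact_iff]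
    intro z hz
    change (magnitudeComplex G l).d (k + 1) k z = 0 at hz
    rw [hd k] at hz
    obtain ⟨w, hw⟩ := exists_boundary_eq hconn hgeo hpto hkl z
      ((toListChain_boundary hconn k l z).symm.trans ((congrArg _ hz).trans (map_zero _)))
    refine ⟨w, ?_⟩
    change (magnitudeComplex G l).d (k + 2) (k + 1) w = z
    rw [hd (k + 1)]
    exact hw

end MagnitudeHomology

theorem mainTheorem6 {V : Type u} [Finite V] (G : SimpleGraph V) (hconn : G.Connected)
    (hgeo : MagnitudeHomology.IsGeodetic G) (hpto : MagnitudeHomology.IsPtolemaic G) :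
    MagnitudeHomology.IsDiagonal G := by
  intro k l h
  by_contra hkl
  exact h ((HomologicalComplex.exactAt_iff_isZero_homology _ _).1
    (MagnitudeHomology.magnitudeComplex_exactAt hconn hgeo hpto hkl))
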